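/- **Setting.** Let $\rho$ be a density matrix and $O$ a Hermitian observable on $n$ qubits. Consider the circuit $U(\vec\theta)=\prod_{l=1}^M V_l\,e^{-i\theta_{S(l)}H_l}$ (ordered product, $l=1$ leftmost) with fixed unitaries $V_l$, Hermitian generators $H_l$, parameters $\vec\theta\in\mathbb R^m$, and an arbitrary map $S:\{1,\dots,M\}\to\{1,\dots,m\}$, so that several generators may share a parameter. Let $\mathcal L(\vec\theta)=\mathrm{Tr}[U(\vec\theta)\rho U(\vec\theta)^\dagger O]$, let $\|\cdot\|$ be the operator norm, and for $\vec\phi\in\mathbb R^m$ and $p\in\{1,\dots,m\}$ put $$c_p(\vec\phi)=\Big|\tfrac{\partial^2\mathcal L}{\partial\theta_p^2}(\vec\phi)\Big|,\qquad \omega_q=\sum_{l\in S^{-1}(q)}\big(\lambda_{\max}(H_l)-\lambda_{\min}(H_l)\big),$$ $$r_{\rm patch}^2=\frac{9\,c_p(\vec\phi)^2}{8\big(16\,c_p(\vec\phi)\|O\|\omega_p^2\sum_{q\ne p}\omega_q^2+32\|O\|^2\omega_p^6\big)}$$ (with the convention $r_{\rm patch}=0$ if the denominator vanishes). $\mathrm{Var}_r$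 denotes the variance of $\mathcal L(\vec\theta)$ for $\vec\theta$ uniform on the hypercube $\prod_i[\phi_i-r,\phi_i+r]$. **(1)** For all $n,m,M$, all such data, every $\vec\phi$, every parameter $p$ and every $r>0$ with $r^2\le r_{\rm patch}^2$, $$\mathrm{Var}_r\ \ge\ \frac{r^4}{45}\Big[\Big(c_p(\vec\phi)-\tfrac83\|O\|\omega_p^2\big(\textstyle\sum_{q\ne p}\omega_q^2\big)r^2\Big)^2-\tfrac{32}{3}\|O\|^2\omega_p^6r^2\Big]\ \ge\ \frac1{72}c_p(\vec\phi)^2r^4 .$$ In particular, this holds for $r=r_{\rm patch}$ when $r_{\rm patch}>0$. **(2)** For every $a\in\mathbb N$ there is $k_0\in\mathbb N$ such that for every integer $k\ge k_0$ there is $j\in\mathbb N$ with the following property. Take any family of such data indexed by the number $n$ of qubits, with arbitrary $m=m(n)$, $M=M(n)$, points $\vec\phi=\vec\phi(n)$ and parameters $p=p(n)$, such that as $n\to\infty$: $\|O\|\in\mathcal O(n^a)$; $\|H_l\|\in\mathcal O(n^a)$ uniformly in $l$; each parameter is shared by at most $\mathcal O(n^a)$ generators, uniformly over the parameters; and $c_p(\vec\phi)\in\Omega(n^{-a})$.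 Then for every choice of $r=r(n)>0$ with $r\in\Theta\big(\tfrac1{n^k\sqrt m}\big)$, $$\mathrm{Var}_r\in\Omega\Big(\frac1{n^j\,m^2}\Big).$$ -/

import Mathlib

section

open scoped ComplexOrder

/-- Linear operators on the Hilbert space of `n` qubits, as matrices in the computational basis
(basis vectors are bit strings of length `n`, so the dimension is `2 ^ n`). -/
abbrev QubitOp (n : ℕ) : Type := Matrix (Fin n → Fin 2) (Fin n → Fin 2) ℂ

/-- The operator (spectral) norm of an operator on `n` qubits. -/
noncomputable def QubitOp.opNorm {n : ℕ} (A : QubitOp n) : ℝ :=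
  ‖Matrix.toEuclideanCLM (n := Fin n → Fin 2) (𝕜 := ℂ) A‖

/-- The maximal frequency of a Hermitian generator: largest minus smallest eigenvalue. -/
noncomputable def QubitOp.maxFreq {n : ℕ} (H : QubitOp n) (hH : H.IsHermitian) : ℝ :=
  (⨆ i, hH.eigenvalues i) - ⨅ i, hH.eigenvalues i

/-- The data of a variational loss on `n` qubits with `m` parameters and `M` gates:
an input state, an observable, fixed unitaries, Hermitian generators, and the map assigning to
each gate the parameter that drives it (several gates may share a parameter). -/
structure QuantumLoss (n m M : ℕ) where
  /-- input state -/
  rho : QubitOp n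
  rho_posSemidef : rho.PosSemidef
  rho_trace : rho.trace = 1
  /-- observable -/
  O : QubitOp n
  O_hermitian : O.IsHermitian
  /-- fixed unitaries -/
  V : Fin M → QubitOp n
  V_unitary : ∀ l, V l ∈ Matrix.unitaryGroup (Fin n → Fin 2) ℂ
  /-- generators -/
  H : Fin M → QubitOp n
  H_hermitian : ∀ l, (H l).IsHermitian
  /-- parameter used by each gate -/
  S : Fin M → Fin m

namespace QuantumLoss

/-- The rotation `exp (-i t H_l)`. -/
noncomputable def gate {n m M : ℕ} (Q : QuantumLoss n m M) (l : Fin M) (t : ℝ) : QubitOp n :=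
  NormedSpace.exp ((-Complex.I * (t : ℂ)) • Q.H l)

/-- The circuit `V_1 U_1 V_2 U_2 ⋯ V_M U_M`, an ordered product with `U_l = exp (-i θ_{S(l)} H_l)`. -/
noncomputable def circuit {n m M : ℕ} (Q : QuantumLoss n m M) (θ : Fin m → ℝ) : QubitOp n :=
  (List.ofFn fun l : Fin M => Q.V l * Q.gate l (θ (Q.S l))).prod

/-- The loss `Tr[U(θ) ρ U(θ)† O]` (this trace is real, see `loss_eq_trace`). -/
noncomputable def loss {n m M : ℕ} (Q : QuantumLoss n m M) (θ : Fin m → ℝ) : ℝ :=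
  (Q.circuit θ * Q.rho * (Q.circuit θ).conjTranspose * Q.O).trace.re

theorem loss_eq_trace {n m M : ℕ} (Q : QuantumLoss n m M) (θ : Fin m → ℝ) :
    (Q.loss θ : ℂ) = (Q.circuit θ * Q.rho * (Q.circuit θ).conjTranspose * Q.O).trace := by
  apply Complex.conj_eq_iff_re.mp
  change star _ = _
  rw [← Matrix.trace_conjTranspose]
  simp only [Matrix.conjTranspose_mul, Matrix.conjTranspose_conjTranspose, Q.O_hermitian.eq,
    Q.rho_posSemidef.isHermitian.eq]
  rw [Matrix.trace_mul_comm]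
  simp only [Matrix.mul_assoc]

/-- The hypercube of all `θ` with `θ i ∈ [φ i - r, φ i + r]` for every `i`. -/
def hypercube {m : ℕ} (φ : Fin m → ℝ) (r : ℝ) : Set (Fin m → ℝ) :=
  Set.Icc (fun i => φ i - r) (fun i => φ i + r)

/-- Variance of the loss when `θ` is uniform on the hypercube of half-width `r` around `φ`. -/
noncomputable def lossVariance {n m M : ℕ} (Q : QuantumLoss n m M) (φ : Fin m → ℝ) (r : ℝ) : ℝ :=
  ProbabilityTheory.variance Q.loss
    (ProbabilityTheory.cond MeasureTheory.volume (hypercube φ r))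

/-- `c_p(φ)`: absolute value of the second partial derivative of the loss in parameter `p`. -/
noncomputable def curvature {n m M : ℕ} (Q : QuantumLoss n m M) (φ : Fin m → ℝ) (p : Fin m) : ℝ :=
  |iteratedDeriv 2 (fun t : ℝ => Q.loss (Function.update φ p t)) (φ p)|

/-- `ω_q`: sum of the maximal frequencies of the generators driven by parameter `q`. -/
noncomputable def omega {n m M : ℕ} (Q : QuantumLoss n m M) (q : Fin m) : ℝ :=
  ∑ l ∈ Finset.univ.filter (fun l => Q.S l = q), QubitOp.maxFreq (Q.H l) (Q.H_hermitian l)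

/-- The sum of `ω_q ^ 2` over all parameters `q ≠ p`. -/
noncomputable def otherOmegaSq {n m M : ℕ} (Q : QuantumLoss n m M) (p : Fin m) : ℝ :=
  ∑ q ∈ Finset.univ.filter (fun q => q ≠ p), Q.omega q ^ 2

/-- The squared patch radius `r_patch ^ 2` at `φ` for parameter `p`. -/
noncomputable def patchRadiusSq {n m M : ℕ} (Q : QuantumLoss n m M) (φ : Fin m → ℝ)
    (p : Fin m) : ℝ :=
  9 * Q.curvature φ p ^ 2 /
    (8 * (16 * Q.curvature φ p * Q.O.opNorm * Q.omega p ^ 2 * Q.otherOmegaSq p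
      + 32 * Q.O.opNorm ^ 2 * Q.omega p ^ 6))

/-- The explicit lower bound on the variance. -/
noncomputable def varianceBound {n m M : ℕ} (Q : QuantumLoss n m M) (φ : Fin m → ℝ)
    (p : Fin m) (r : ℝ) : ℝ :=
  r ^ 4 / 45 *
    ((Q.curvature φ p - 8 / 3 * Q.O.opNorm * Q.omega p ^ 2 * Q.otherOmegaSq p * r ^ 2) ^ 2
      - 32 / 3 * Q.O.opNorm ^ 2 * Q.omega p ^ 6 * r ^ 2)

end QuantumLoss

end

/-
Let `c` be the second partial derivative of the loss at `φ` in the parameter `p`. By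
Cauchy-Schwarz, the variance of the loss is at least its squared covariance with any test function
`P`, divided by the variance of `P`. For `P` take the second Legendre polynomial in the coordinate
`p`: it is orthogonal to affine and to odd functions, so Taylor expansion to order four in that
coordinate shows that the covariance is `2 r ^ 4 / 45` times the average of the second derivative
over the other coordinates, with an error controlled by the fourth derivative. Changing one
coordinate `q ≠ p` at a time and expanding to order two, that average differs from `c` by a
multiple of `r ^ 2` times mixed fourth derivatives.

All derivatives are controlled by one mechanism. Shifting each generator by the midpoint of its
spectrum changes the circuit only by a phase and makes the norm of the generator half its maximal
frequency. The product rule, applied to `U(θ)† O U(θ)`, then makes each derivative in the parameter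
`q` cost a factor `ω_q`.
-/

open Function Set MeasureTheory ProbabilityTheory

/-- `f` is continuous and bounded by `C`, and its iterated partial derivatives of order at most
`k` exist and are continuous, each derivative in the coordinate `q` costing a factor `w q` in the
bound. Partial derivatives are given existentially along `Function.update`, so that no Fréchet
derivative in all coordinates at once is needed. -/
def PartialsBounded {ι A : Type*} [DecidableEq ι] [NormedAddCommGroup A] [NormedSpace ℝ A]
    (w : ι → ℝ) : ℕ → ℝ → ((ι → ℝ) → A) → Prop
  | 0, C, f => Continuous f ∧ ∀ x, ‖f x‖ ≤ C
  | k + 1, C, f => (Continuous f ∧ ∀ x, ‖f x‖ ≤ C) ∧ ∀ q, ∃ g : (ι → ℝ) → A,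
      (∀ x, HasDerivAt (fun t => f (update x q t)) (g x) (x q)) ∧
        PartialsBounded w k (C * w q) g

namespace PartialsBounded

variable {ι : Type*} [DecidableEq ι] {v w : ι → ℝ} {k : ℕ} {C D : ℝ}

section NormedSpace

variable {A B : Type*} [NormedAddCommGroup A] [NormedSpace ℝ A]
  [NormedAddCommGroup B] [NormedSpace ℝ B] {f g : (ι → ℝ) → A}

theorem continuous (hf : PartialsBounded w k C f) : Continuous f := by
  cases k with
  | zero => exact hf.1
  | succ k => exact hf.1.1

theorem norm_le (hf : PartialsBounded w k C f) (x : ι → ℝ) : ‖f x‖ ≤ C := by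
  cases k with
  | zero => exact hf.2 x
  | succ k => exact hf.1.2 x

theorem nonneg (hf : PartialsBounded w k C f) : 0 ≤ C :=
  (norm_nonneg _).trans (hf.norm_le 0)

theorem of_succ (hf : PartialsBounded w (k + 1) C f) : PartialsBounded w k C f := by
  induction k generalizing C f with
  | zero => exact hf.1
  | succ k ih =>
    refine ⟨hf.1, fun q => ?_⟩
    obtain ⟨f', hf', hf''⟩ := hf.2 q
    exact ⟨f', hf', ih hf''⟩

theorem const (hw : 0 ≤ w) (k : ℕ) {a : A} (ha : ‖a‖ ≤ C) :
    PartialsBounded w k C (fun _ => a) := by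
  induction k generalizing C a with
  | zero => exact ⟨continuous_const, fun _ => ha⟩
  | succ k ih =>
    refine ⟨⟨continuous_const, fun _ => ha⟩, fun q =>
      ⟨fun _ => 0, fun x => hasDerivAt_const _ _, ih ?_⟩⟩
    simpa using mul_nonneg ((norm_nonneg _).trans ha) (hw q)

theorem add (hf : PartialsBounded w k C f) (hg : PartialsBounded w k D g) :
    PartialsBounded w k (C + D) (f + g) := by
  have hfg : Continuous (f + g) ∧ ∀ x, ‖(f + g) x‖ ≤ C + D :=
    ⟨hf.continuous.add hg.continuous, fun x => norm_add_le_of_le (hf.norm_le x) (hg.norm_le x)⟩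
  induction k generalizing C D f g with
  | zero => exact hfg
  | succ k ih =>
    refine ⟨hfg, fun q => ?_⟩
    obtain ⟨f', hf', hf''⟩ := hf.2 q
    obtain ⟨g', hg', hg''⟩ := hg.2 q
    refine ⟨f' + g', fun x => (hf' x).add (hg' x), ?_⟩
    rw [add_mul]
    exact ih hf'' hg'' ⟨hf''.continuous.add hg''.continuous,
      fun x => norm_add_le_of_le (hf''.norm_le x) (hg''.norm_le x)⟩

theorem clm_comp {c : ℝ} (T : A →L[ℝ] B) (hT : ‖T‖ ≤ c) (hf : PartialsBounded w k C f) :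
    PartialsBounded w k (c * C) (T ∘ f) := by
  have hTf : Continuous (T ∘ f) ∧ ∀ x, ‖(T ∘ f) x‖ ≤ c * C :=
    ⟨T.continuous.comp hf.continuous, fun x => T.le_of_opNorm_le_of_le hT (hf.norm_le x)⟩
  induction k generalizing C f with
  | zero => exact hTf
  | succ k ih =>
    refine ⟨hTf, fun q => ?_⟩
    obtain ⟨f', hf', hf''⟩ := hf.2 q
    refine ⟨T ∘ f', fun x => T.hasFDerivAt.comp_hasDerivAt (x q) (hf' x), ?_⟩
    rw [mul_assoc]
    exact ih hf'' ⟨T.continuous.comp hf''.continuous,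
      fun x => T.le_of_opNorm_le_of_le hT (hf''.norm_le x)⟩

theorem exists_iterated_partials (hf : PartialsBounded w k C f) (p : ι) :
    ∃ g : ℕ → (ι → ℝ) → A, g 0 = f ∧
      (∀ j < k, ∀ x t, HasDerivAt (fun s => g j (update x p s)) (g (j + 1) (update x p t)) t) ∧
      ∀ j ≤ k, PartialsBounded w (k - j) (C * w p ^ j) (g j) := by
  induction k generalizing C f with
  | zero => exact ⟨fun _ => f, rfl, by simp, by simpa using hf⟩
  | succ k ih =>
    obtain ⟨f', hf', hf''⟩ := hf.2 p
    obtain ⟨g, rfl, hg, hbound⟩ := ih hf''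
    refine ⟨fun j => j.casesOn f g, rfl, fun j hj x t => ?_, fun j hj => ?_⟩
    · cases j with
      | zero => simpa using hf' (update x p t)
      | succ j => exact hg j (by lia) x t
    · cases j with
      | zero => simpa using hf
      | succ j => simpa [pow_succ', mul_assoc] using hbound j (by lia)

end NormedSpace

section NormedAlgebra

variable {A : Type*} [NormedRing A] [NormedAlgebra ℝ A] {f g : (ι → ℝ) → A}

theorem mul (hf : PartialsBounded v k C f) (hg : PartialsBounded w k D g) :
    PartialsBounded (v + w) k (C * D) (f * g) := by
  have hfg : Continuous (f * g) ∧ ∀ x, ‖(f * g) x‖ ≤ C * D :=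
    ⟨hf.continuous.mul hg.continuous, fun x => norm_mul_le_of_le (hf.norm_le x) (hg.norm_le x)⟩
  induction k generalizing C D f g with
  | zero => exact hfg
  | succ k ih =>
    refine ⟨hfg, fun q => ?_⟩
    obtain ⟨f', hf', hf''⟩ := hf.2 q
    obtain ⟨g', hg', hg''⟩ := hg.2 q
    refine ⟨f' * g + f * g', fun x => ?_, ?_⟩
    · simpa only [update_eq_self] using! (hf' x).mul (hg' x)
    rw [show C * D * (v + w) q = C * v q * D + C * (D * w q) by rw [Pi.add_apply]; ring]
    refine (ih hf'' hg.of_succ ⟨?_, fun x => ?_⟩).add (ih hf.of_succ hg'' ⟨?_, fun x => ?_⟩)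
    · exact hf''.continuous.mul hg.continuous
    · exact norm_mul_le_of_le (hf''.norm_le x) (hg.norm_le x)
    · exact hf.continuous.mul hg''.continuous
    · exact norm_mul_le_of_le (hf.norm_le x) (hg''.norm_le x)

theorem exp_smul [CompleteSpace A] (i : ι) {a : A} {b : ℝ} (ha : ‖a‖ ≤ b)
    (hexp : ∀ t : ℝ, ‖NormedSpace.exp (t • a)‖ ≤ 1) (k : ℕ) :
    PartialsBounded (Pi.single i b) k 1 (fun x : ι → ℝ => NormedSpace.exp (x i • a)) := by
  have hderiv := fun t : ℝ => hasDerivAt_exp_smul_const a t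
  have hcont : Continuous fun x : ι → ℝ => NormedSpace.exp (x i • a) :=
    (continuous_iff_continuousAt.2 fun t => (hderiv t).continuousAt).comp (continuous_apply i)
  induction k with
  | zero => exact ⟨hcont, fun x => hexp _⟩
  | succ k ih =>
    refine ⟨⟨hcont, fun x => hexp _⟩, fun q => ?_⟩
    rcases eq_or_ne q i with rfl | hq
    · refine ⟨(fun x => NormedSpace.exp (x q • a)) * fun _ => a, fun x => ?_, ?_⟩
      · simpa using hderiv (x q)
      · simpa using ih.mul (const (w := 0) le_rfl k ha)
    · refine ⟨fun _ => 0, fun x => ?_, const (Pi.single_nonneg.2 ((norm_nonneg a).trans ha)) k ?_⟩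
      · simpa [update_of_ne hq.symm] using hasDerivAt_const (x q) (NormedSpace.exp (x i • a))
      · simp [hq]

theorem list_prod [NormOneClass A] {α : Type*} {w : α → ι → ℝ} {f : α → (ι → ℝ) → A}
    (hf : ∀ l, PartialsBounded (w l) k 1 (f l)) (L : List α) :
    PartialsBounded (L.map w).sum k 1 (L.map f).prod := by
  induction L with
  | nil => exact const (w := (0 : ι → ℝ)) le_rfl k (norm_one (α := A)).le
  | cons l L ih => simpa using (hf l).mul ih

end NormedAlgebra

end PartialsBounded

section Taylor

variable {E : Type*} [NormedAddCommGroup E] [NormedSpace ℝ E]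

theorem norm_le_mul_abs_pow_succ {f f' : ℝ → E} {a K : ℝ} {n : ℕ}
    (hderiv : ∀ x, HasDerivAt f (f' x) x) (ha : f a = 0) (hK : ∀ x, ‖f' x‖ ≤ K * |x - a| ^ n)
    (hK₀ : 0 ≤ K) (x : ℝ) : ‖f x‖ ≤ K * |x - a| ^ (n + 1) := by
  have hbound : ∀ y ∈ uIcc a x, ‖f' y‖ ≤ K * |x - a| ^ n := fun y hy => by
    have := abs_sub_left_of_mem_uIcc hy
    exact (hK y).trans (by gcongr)
  simpa [ha, pow_succ, mul_assoc] using
    (convex_uIcc a x).norm_image_sub_le_of_norm_hasDerivWithin_le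
      (fun y _ => (hderiv y).hasDerivWithinAt) hbound left_mem_uIcc right_mem_uIcc

theorem norm_sub_taylor_sum_le {u : ℕ → ℝ → E} {n : ℕ} {K : ℝ}
    (hu : ∀ j < n, ∀ x, HasDerivAt (u j) (u (j + 1) x) x) (hK : ∀ x, ‖u n x‖ ≤ K) (a x : ℝ) :
    ‖u 0 x - ∑ j ∈ Finset.range n, ((x - a) ^ j / j.factorial) • u j a‖ ≤ K * |x - a| ^ n := by
  induction n generalizing u x with
  | zero => simpa using hK x
  | succ n ih =>
    refine norm_le_mul_abs_pow_succ (f := fun y => u 0 y -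
        ∑ j ∈ Finset.range (n + 1), ((y - a) ^ j / j.factorial) • u j a)
      (f' := fun y => u 1 y - ∑ j ∈ Finset.range n, ((y - a) ^ j / j.factorial) • u (j + 1) a)
      (fun y => ?_) ?_ (ih (u := fun j => u (j + 1)) (fun j hj => hu (j + 1) (by lia)) hK)
      ((norm_nonneg _).trans (hK 0)) x
    · simp only [Finset.sum_range_succ', pow_zero, Nat.factorial_zero, Nat.cast_one, div_one,
        one_smul]
      refine (hu 0 n.succ_pos y).sub (HasDerivAt.add_const _ (HasDerivAt.fun_sum fun j _ => ?_))
      have hpow := (((hasDerivAt_id y).sub_const a).pow (j + 1)).div_const ((j + 1).factorial : ℝ)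
      refine (hpow.smul_const (u (j + 1) a)).congr_deriv ?_
      congr 1
      push_cast [Nat.factorial_succ, id]
      have : (j.factorial : ℝ) ≠ 0 := by positivity
      simp only [mul_one]
      field_simp
    · simp [Finset.sum_range_succ']

theorem iteratedDeriv_eq_of_hasDerivAt {u : ℕ → ℝ → E} {n : ℕ}
    (hu : ∀ j < n, ∀ x, HasDerivAt (u j) (u (j + 1) x) x) : iteratedDeriv n (u 0) = u n := by
  induction n with
  | zero => exact iteratedDeriv_zero
  | succ n ih =>
    rw [iteratedDeriv_succ, ih fun j hj => hu j (by lia)]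
    exact funext fun x => (hu n n.lt_succ_self x).deriv

end Taylor

section ProductMeasure

variable {ι : Type*} [Fintype ι] {X : ι → Type*} [∀ i, MeasurableSpace (X i)]

theorem cond_pi_univ_pi (μ : ∀ i, Measure (X i)) [∀ i, SigmaFinite (μ i)] {s : ∀ i, Set (X i)}
    (hs : ∀ i, MeasurableSet (s i)) (h₀ : ∀ i, μ i (s i) ≠ 0) (h_top : ∀ i, μ i (s i) ≠ ⊤) :
    cond (Measure.pi μ) (univ.pi s) = Measure.pi fun i => cond (μ i) (s i) := by
  have := fun i => cond_isProbabilityMeasure_of_finite (h₀ i) (h_top i)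
  refine (Measure.pi_eq fun t _ => ?_).symm
  simp only [cond_apply (hs _), cond_apply (MeasurableSet.univ_pi hs), ← pi_inter_distrib,
    Measure.pi_pi, Finset.prod_mul_distrib]
  rw [ENNReal.prod_inv_distrib fun i _ _ _ _ => Or.inl (h₀ i)]

variable [DecidableEq ι]

theorem measurePreserving_update (μ : ∀ i, Measure (X i)) [∀ i, SigmaFinite (μ i)] (q : ι)
    [IsProbabilityMeasure (μ q)] :
    MeasurePreserving (fun z : (∀ i, X i) × X q => update z.1 q z.2)
      ((Measure.pi μ).prod (μ q)) (Measure.pi μ) := by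
  have hmeas : Measurable fun z : (∀ i, X i) × X q => update z.1 q z.2 := measurable_update'
  refine ⟨hmeas, (Measure.pi_eq fun s hs => ?_).symm⟩
  have hpre : (fun z : (∀ i, X i) × X q => update z.1 q z.2) ⁻¹' univ.pi s =
      univ.pi (update s q univ) ×ˢ s q := by
    ext z
    simp only [mem_preimage, mem_univ_pi, mem_prod]
    refine ⟨fun h => ⟨fun i => ?_, by simpa using h q⟩, fun h i => ?_⟩
    · rcases eq_or_ne i q with rfl | hi
      · simp
      · simpa [hi] using h i
    · rcases eq_or_ne i q with rfl | hi
      · simpa using h.2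
      · simpa [hi] using h.1 i
  rw [Measure.map_apply hmeas (MeasurableSet.univ_pi hs), hpre, Measure.prod_prod, Measure.pi_pi,
    ← Finset.mul_prod_erase _ _ (Finset.mem_univ q),
    ← Finset.mul_prod_erase _ _ (Finset.mem_univ q), update_self, measure_univ, one_mul, mul_comm]
  congr 1
  exact Finset.prod_congr rfl fun i hi => by rw [update_of_ne (Finset.ne_of_mem_erase hi)]

variable {E : Type*} [NormedAddCommGroup E] [NormedSpace ℝ E] (μ : ∀ i, Measure (X i))
  [∀ i, SigmaFinite (μ i)] (q : ι) [IsProbabilityMeasure (μ q)] {F : (∀ i, X i) → E}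

theorem integrable_integral_update (hF : Integrable F (Measure.pi μ)) :
    Integrable (fun y => ∫ t, F (update y q t) ∂μ q) (Measure.pi μ) :=
  ((measurePreserving_update μ q).integrable_comp_of_integrable hF).integral_prod_left

theorem integral_integral_update (hF : Integrable F (Measure.pi μ)) :
    ∫ y, ∫ t, F (update y q t) ∂μ q ∂Measure.pi μ = ∫ y, F y ∂Measure.pi μ := by
  have hupdate := measurePreserving_update μ q
  have hF' : AEStronglyMeasurable F (Measure.map _ ((Measure.pi μ).prod (μ q))) :=
    hupdate.map_eq.symm ▸ hF.aestronglyMeasurable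
  calc ∫ y, ∫ t, F (update y q t) ∂μ q ∂Measure.pi μ
      = ∫ z, F (update z.1 q z.2) ∂(Measure.pi μ).prod (μ q) :=
        (integral_prod _ (hupdate.integrable_comp_of_integrable hF)).symm
    _ = ∫ y, F y ∂Measure.pi μ := by
        rw [← integral_map hupdate.aemeasurable hF', hupdate.map_eq]

end ProductMeasure

theorem sq_covariance_le_mul_variance {Ω : Type*} [MeasurableSpace Ω] {μ : Measure Ω}
    [IsFiniteMeasure μ] {X Y : Ω → ℝ} (hX : MemLp X 2 μ) (hY : MemLp Y 2 μ) :
    cov[X, Y; μ] ^ 2 ≤ Var[X; μ] * Var[Y; μ] := by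
  have hquad : ∀ c : ℝ, 0 ≤ Var[Y; μ] * (c * c) + 2 * cov[X, Y; μ] * c + Var[X; μ] := fun c => by
    have := variance_nonneg (X + c • Y) μ
    rw [variance_add hX (hY.const_smul c), variance_smul, covariance_smul_right] at this
    linarith
  have := discrim_le_zero hquad
  rw [discrim] at this
  linarith

theorem mul_sub_le_variance_mul_variance {Ω : Type*} [MeasurableSpace Ω] {μ : Measure Ω}
    [IsFiniteMeasure μ] {X Y : Ω → ℝ} (hX : MemLp X 2 μ) (hY : MemLp Y 2 μ) {m d e : ℝ}
    (hm : 0 ≤ m) (hcov : |cov[X, Y; μ] - m * d| ≤ m * e) :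
    m ^ 2 * (d ^ 2 - 2 * |d| * e) ≤ Var[X; μ] * Var[Y; μ] := by
  have hprod : |m * d * (cov[X, Y; μ] - m * d)| ≤ m * |d| * (m * e) := by
    rw [abs_mul, abs_mul, abs_of_nonneg hm]
    gcongr
  calc m ^ 2 * (d ^ 2 - 2 * |d| * e)
      = 2 * (m * d) * (m * d) - (m * d) ^ 2 - 2 * (m * |d| * (m * e)) := by ring
    _ ≤ cov[X, Y; μ] ^ 2 := by
        linarith [neg_le_of_abs_le hprod, sq_nonneg (cov[X, Y; μ] - m * d)]
    _ ≤ Var[X; μ] * Var[Y; μ] := sq_covariance_le_mul_variance hX hY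

theorem abs_integral_sub_le_mul_variance {u : ℕ → ℝ → ℝ} {K : ℝ}
    (hu : ∀ j < 2, ∀ x, HasDerivAt (u j) (u (j + 1) x) x) (hK : ∀ x, |u 2 x| ≤ K)
    {ν : Measure ℝ} [IsProbabilityMeasure ν] (hν : MemLp id 2 ν) :
    |∫ t, u 0 t ∂ν - u 0 (∫ t, t ∂ν)| ≤ K * Var[id; ν] := by
  set a := ∫ t, t ∂ν with ha
  have hid : Integrable (fun t => t) ν := hν.integrable one_le_two
  have hsq : Integrable (fun t => K * (t - a) ^ 2) ν :=
    ((hν.sub (memLp_const a)).integrable_sq).const_mul K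
  have hsub : Integrable (fun t => t - a) ν := hid.sub (integrable_const a)
  have hlin : Integrable (fun t => u 0 a + (t - a) * u 1 a) ν :=
    (integrable_const _).add (hsub.mul_const _)
  have htaylor : ∀ t, |u 0 t - (u 0 a + (t - a) * u 1 a)| ≤ K * (t - a) ^ 2 := fun t => by
    simpa [Finset.sum_range_succ] using norm_sub_taylor_sum_le hu hK a t
  have hcont : Continuous (u 0) :=
    continuous_iff_continuousAt.2 fun x => (hu 0 two_pos x).continuousAt
  have hrem : Integrable (fun t => u 0 t - (u 0 a + (t - a) * u 1 a)) ν :=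
    hsq.mono' (by fun_prop) (.of_forall htaylor)
  have hlin_eq : ∫ t, (u 0 a + (t - a) * u 1 a) ∂ν = u 0 a := by
    rw [integral_add (integrable_const _) (hsub.mul_const _), integral_mul_const,
      integral_sub hid (integrable_const a), ← ha]
    simp
  have hu₀ : Integrable (u 0) ν := (hrem.add hlin).congr (.of_forall fun t => by simp)
  calc |∫ t, u 0 t ∂ν - u 0 a| = |∫ t, (u 0 t - (u 0 a + (t - a) * u 1 a)) ∂ν| := by
        rw [integral_sub hu₀ hlin, hlin_eq]
    _ ≤ ∫ t, K * (t - a) ^ 2 ∂ν :=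
        norm_integral_le_of_norm_le (f := fun t => u 0 t - (u 0 a + (t - a) * u 1 a)) hsq
          (.of_forall htaylor)
    _ = K * Var[id; ν] := by
        rw [integral_const_mul, variance_eq_integral aemeasurable_id]
        rfl

namespace PartialsBounded

variable {ι : Type*} [DecidableEq ι] {w : ι → ℝ} {k : ℕ} {C : ℝ}

theorem memLp_comp {A Ω : Type*} [NormedAddCommGroup A] [NormedSpace ℝ A] {f : (ι → ℝ) → A}
    (hf : PartialsBounded w k C f) [TopologicalSpace Ω] [MeasurableSpace Ω]
    [OpensMeasurableSpace Ω] [SecondCountableTopology Ω] {F : Ω → ι → ℝ} (hF : Continuous F)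
    (p : ENNReal) (μ : Measure Ω) [IsFiniteMeasure μ] : MemLp (fun x => f (F x)) p μ :=
  .of_bound (hf.continuous.comp hF).aestronglyMeasurable C (.of_forall fun _ => hf.norm_le _)

theorem integrable_comp {A Ω : Type*} [NormedAddCommGroup A] [NormedSpace ℝ A] {f : (ι → ℝ) → A}
    (hf : PartialsBounded w k C f) [TopologicalSpace Ω] [MeasurableSpace Ω]
    [OpensMeasurableSpace Ω] [SecondCountableTopology Ω] {F : Ω → ι → ℝ} (hF : Continuous F)
    (μ : Measure Ω) [IsFiniteMeasure μ] : Integrable (fun x => f (F x)) μ :=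
  memLp_one_iff_integrable.1 (hf.memLp_comp hF 1 μ)

theorem abs_integral_update_sub_le {f : (ι → ℝ) → ℝ} (hf : PartialsBounded w 2 C f) (q : ι)
    {ν : Measure ℝ} [IsProbabilityMeasure ν] (hν : MemLp id 2 ν) (x : ι → ℝ) :
    |∫ t, f (update x q t) ∂ν - f (update x q (∫ t, t ∂ν))| ≤ C * w q ^ 2 * Var[id; ν] := by
  obtain ⟨g, rfl, hderiv, hbound⟩ := hf.exists_iterated_partials q
  exact abs_integral_sub_le_mul_variance (u := fun j t => g j (update x q t))
    (fun j hj => hderiv j hj x) (fun t => (hbound 2 le_rfl).norm_le _) hν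

theorem abs_integral_piecewise_sub_le [Fintype ι] {f : (ι → ℝ) → ℝ} (hf : PartialsBounded w 2 C f)
    (μ : ι → Measure ℝ) [∀ i, IsProbabilityMeasure (μ i)] (hμ : ∀ i, MemLp id 2 (μ i))
    {φ : ι → ℝ} (hφ : ∀ i, ∫ t, t ∂μ i = φ i) (T : Finset ι) :
    |∫ y, f (T.piecewise y φ) ∂Measure.pi μ - f φ| ≤ C * ∑ q ∈ T, w q ^ 2 * Var[id; μ q] := by
  have hcont (T : Finset ι) : Continuous fun y => T.piecewise y φ := by
    refine continuous_pi fun i => ?_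
    by_cases hi : i ∈ T <;> simp only [Finset.piecewise, hi, if_true, if_false] <;> fun_prop
  induction T using Finset.induction_on with
  | empty => simp
  | insert q T hq ih =>
    have hint := hf.integrable_comp (hcont (insert q T)) (Measure.pi μ)
    have hinsert (y : ι → ℝ) (t : ℝ) : (insert q T).piecewise (update y q t) φ =
        update (T.piecewise y φ) q t := by
      rw [Finset.piecewise_insert, update_self]
      congr 1
      exact T.piecewise_congr
        (fun i hi => update_of_ne (ne_of_mem_of_not_mem hi hq) _ _) fun _ _ => rfl
    have hcoord (y : ι → ℝ) : |∫ t, f ((insert q T).piecewise (update y q t) φ) ∂μ q -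
        f (T.piecewise y φ)| ≤ C * (w q ^ 2 * Var[id; μ q]) := by
      have hq' : update (T.piecewise y φ) q (φ q) = T.piecewise y φ := by simp [hq]
      simpa only [hinsert, hφ, hq', mul_assoc] using
        hf.abs_integral_update_sub_le q (hμ q) (T.piecewise y φ)
    have hstep : |∫ y, f ((insert q T).piecewise y φ) ∂Measure.pi μ -
        ∫ y, f (T.piecewise y φ) ∂Measure.pi μ| ≤ C * (w q ^ 2 * Var[id; μ q]) := by
      rw [← integral_integral_update μ q hint, ← integral_sub (integrable_integral_update μ q hint)
        (hf.integrable_comp (hcont T) _)]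
      simpa using norm_integral_le_of_norm_le_const (μ := Measure.pi μ)
        (f := fun y => ∫ t, f ((insert q T).piecewise (update y q t) φ) ∂μ q -
          f (T.piecewise y φ)) (.of_forall hcoord)
    rw [Finset.sum_insert hq, mul_add]
    exact (abs_sub_le _ _ _).trans (add_le_add hstep ih)

end PartialsBounded

section UniformInterval

/-- The uniform distribution on the interval of half-width `r` around `a`. -/
noncomputable def uniformInterval (a r : ℝ) : Measure ℝ := cond volume (Icc (a - r) (a + r))

/-- The multiple `x² - r² / 3`, `x = t - a`, of the second Legendre polynomial of the interval of
half-width `r` around `a`. It is orthogonal to affine functions, so that testing a function against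
it extracts the second derivative at `a`. -/
noncomputable def legendreQuadratic (a r t : ℝ) : ℝ := (t - a) ^ 2 - r ^ 2 / 3

instance (a r : ℝ) : IsFiniteMeasure (uniformInterval a r) :=
  inferInstanceAs (IsFiniteMeasure (cond volume (Icc (a - r) (a + r))))

variable (a : ℝ) {r : ℝ}

@[fun_prop]
theorem continuous_legendreQuadratic (r : ℝ) : Continuous (legendreQuadratic a r) := by
  unfold legendreQuadratic
  fun_prop

theorem abs_legendreQuadratic_le {t : ℝ} (ht : |t - a| ≤ r) :
    |legendreQuadratic a r t| ≤ 2 / 3 * r ^ 2 := by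
  have hle : (t - a) ^ 2 ≤ r ^ 2 := sq_le_sq.2 (ht.trans (le_abs_self r))
  rw [legendreQuadratic, abs_le]
  constructor <;> linarith [sq_nonneg (t - a)]

theorem volume_Icc_sub_add_ne_zero (hr : 0 < r) : volume (Icc (a - r) (a + r)) ≠ 0 := by
  simp [hr]

theorem ae_uniformInterval_abs_sub_le (r : ℝ) : ∀ᵐ t ∂uniformInterval a r, |t - a| ≤ r := by
  have hmem : ∀ᵐ t ∂uniformInterval a r, t ∈ Icc (a - r) (a + r) := ae_cond_mem measurableSet_Icc
  filter_upwards [hmem] with t ht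
  rwa [← Real.dist_eq, ← Metric.mem_closedBall, Real.closedBall_eq_Icc]

theorem isProbabilityMeasure_uniformInterval (hr : 0 < r) :
    IsProbabilityMeasure (uniformInterval a r) :=
  cond_isProbabilityMeasure_of_finite (volume_Icc_sub_add_ne_zero a hr) measure_Icc_lt_top.ne

theorem memLp_uniformInterval {F : ℝ → ℝ} (hF : Continuous F) (r : ℝ) (p : ENNReal) :
    MemLp F p (uniformInterval a r) := by
  obtain ⟨B, hB⟩ := isCompact_Icc.exists_bound_of_continuousOn
    (s := Icc (a - r) (a + r)) hF.continuousOn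
  have hmem : ∀ᵐ t ∂uniformInterval a r, t ∈ Icc (a - r) (a + r) := ae_cond_mem measurableSet_Icc
  exact .of_bound hF.aestronglyMeasurable B (hmem.mono hB)

theorem integrable_uniformInterval {F : ℝ → ℝ} (hF : Continuous F) (r : ℝ) :
    Integrable F (uniformInterval a r) :=
  memLp_one_iff_integrable.1 (memLp_uniformInterval a hF r 1)

theorem integral_uniformInterval (hr : 0 < r) (F : ℝ → ℝ) :
    ∫ t, F (t - a) ∂uniformInterval a r = (2 * r)⁻¹ * ∫ x in (-r)..r, F x := by
  rw [uniformInterval, ProbabilityTheory.cond, integral_smul_measure, Real.volume_Icc,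
    integral_Icc_eq_integral_Ioc, ← intervalIntegral.integral_of_le (by linarith),
    intervalIntegral.integral_comp_sub_right,
    ENNReal.toReal_inv, ENNReal.toReal_ofReal (by linarith), smul_eq_mul]
  congr 2 <;> ring

theorem integral_pow_uniformInterval (hr : 0 < r) (n : ℕ) :
    ∫ t, (t - a) ^ n ∂uniformInterval a r = if Even n then r ^ n / (n + 1) else 0 := by
  rw [integral_uniformInterval a hr fun x => x ^ n, integral_pow]
  split_ifs with hn
  · rw [hn.add_one.neg_pow]
    field_simp
    ring
  · rw [(Nat.not_even_iff_odd.1 hn).add_one.neg_pow, sub_self, zero_div, mul_zero]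

theorem integral_id_uniformInterval (hr : 0 < r) : ∫ t, t ∂uniformInterval a r = a := by
  have := isProbabilityMeasure_uniformInterval a hr
  have h := integral_pow_uniformInterval a hr 1
  simp only [pow_one, Nat.not_even_one, if_false] at h
  rw [integral_sub (integrable_uniformInterval a (by fun_prop) r) (integrable_const a)] at h
  simpa [sub_eq_zero] using h

theorem variance_id_uniformInterval (hr : 0 < r) : Var[id; uniformInterval a r] = r ^ 2 / 3 := by
  rw [variance_eq_integral aemeasurable_id]
  simp only [id, integral_id_uniformInterval a hr, integral_pow_uniformInterval a hr 2, even_two,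
    if_true]
  norm_num

theorem integral_taylor_mul_legendreQuadratic (hr : 0 < r) (c : ℕ → ℝ) :
    ∫ t, (∑ j ∈ Finset.range 4, (t - a) ^ j / j.factorial * c j) * legendreQuadratic a r t
      ∂uniformInterval a r = 2 * r ^ 4 / 45 * c 2 := by
  have hexpand (t : ℝ) :
      (∑ j ∈ Finset.range 4, (t - a) ^ j / j.factorial * c j) * legendreQuadratic a r t =
        ∑ j ∈ Finset.range 4, (c j / j.factorial * (t - a) ^ (j + 2) -
          c j / j.factorial * (r ^ 2 / 3) * (t - a) ^ j) := by
    rw [Finset.sum_mul]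
    exact Finset.sum_congr rfl fun j _ => by rw [legendreQuadratic]; ring
  simp only [hexpand]
  rw [integral_finsetSum _ fun j _ => integrable_uniformInterval a (by fun_prop) r]
  have hterm (j : ℕ) : ∫ t, (c j / j.factorial * (t - a) ^ (j + 2) -
      c j / j.factorial * (r ^ 2 / 3) * (t - a) ^ j) ∂uniformInterval a r =
      c j / j.factorial * (if Even (j + 2) then r ^ (j + 2) / ((j + 2 : ℕ) + 1) else 0) -
        c j / j.factorial * (r ^ 2 / 3) * (if Even j then r ^ j / (j + 1) else 0) := by
    rw [integral_sub (integrable_uniformInterval a (by fun_prop) r)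
      (integrable_uniformInterval a (by fun_prop) r), integral_const_mul, integral_const_mul,
      integral_pow_uniformInterval a hr, integral_pow_uniformInterval a hr]
  simp only [hterm]
  simp [Finset.sum_range_succ, Nat.even_add_one, Nat.factorial]
  ring

theorem integral_legendreQuadratic (hr : 0 < r) :
    ∫ t, legendreQuadratic a r t ∂uniformInterval a r = 0 := by
  simpa [Finset.sum_range_succ] using
    integral_taylor_mul_legendreQuadratic a hr (Pi.single 0 1)

theorem variance_legendreQuadratic (hr : 0 < r) :
    Var[legendreQuadratic a r; uniformInterval a r] = 4 * r ^ 4 / 45 := by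
  rw [variance_eq_integral (continuous_legendreQuadratic a r).aemeasurable,
    integral_legendreQuadratic a hr]
  let c : ℕ → ℝ := fun j => if j = 0 then -r ^ 2 / 3 else if j = 2 then 2 else 0
  have htaylor (t : ℝ) : legendreQuadratic a r t =
      ∑ j ∈ Finset.range 4, (t - a) ^ j / j.factorial * c j := by
    simp [Finset.sum_range_succ, legendreQuadratic, c]
    ring
  calc ∫ t, (legendreQuadratic a r t - 0) ^ 2 ∂uniformInterval a r
      = ∫ t, (∑ j ∈ Finset.range 4, (t - a) ^ j / j.factorial * c j) * legendreQuadratic a r t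
          ∂uniformInterval a r := by simp only [← htaylor, sub_zero, sq]
    _ = 4 * r ^ 4 / 45 := by
        rw [integral_taylor_mul_legendreQuadratic a hr]
        simp only [OfNat.ofNat_ne_zero, ↓reduceIte, c]
        ring

theorem abs_integral_mul_legendreQuadratic_sub_le {u : ℕ → ℝ → ℝ} {K : ℝ}
    (hu : ∀ j < 4, ∀ x, HasDerivAt (u j) (u (j + 1) x) x) (hK : ∀ x, |u 4 x| ≤ K) (hr : 0 < r) :
    |∫ t, u 0 t * legendreQuadratic a r t ∂uniformInterval a r - 2 * r ^ 4 / 45 * u 2 a| ≤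
      2 * r ^ 4 / 45 * (3 * K * r ^ 2) := by
  set T : ℝ → ℝ := fun t => ∑ j ∈ Finset.range 4, (t - a) ^ j / j.factorial * u j a
  have : Continuous T := by fun_prop
  have hu₀ : Continuous (u 0) :=
    continuous_iff_continuousAt.2 fun x => (hu 0 four_pos x).continuousAt
  have htaylor (t : ℝ) : |u 0 t - T t| ≤ K * (t - a) ^ 4 := by
    simpa [Even.pow_abs ⟨2, rfl⟩] using norm_sub_taylor_sum_le hu hK a t
  have hbound : ∀ᵐ t ∂uniformInterval a r,
      ‖(u 0 t - T t) * legendreQuadratic a r t‖ ≤ 2 / 3 * K * r ^ 2 * (t - a) ^ 4 := by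
    filter_upwards [ae_uniformInterval_abs_sub_le a r] with t ht
    calc ‖(u 0 t - T t) * legendreQuadratic a r t‖
        ≤ K * (t - a) ^ 4 * (2 / 3 * r ^ 2) :=
          norm_mul_le_of_le (htaylor t) (abs_legendreQuadratic_le a ht)
      _ = 2 / 3 * K * r ^ 2 * (t - a) ^ 4 := by ring
  calc |∫ t, u 0 t * legendreQuadratic a r t ∂uniformInterval a r - 2 * r ^ 4 / 45 * u 2 a|
      = |∫ t, (u 0 t - T t) * legendreQuadratic a r t ∂uniformInterval a r| := by
        rw [← integral_taylor_mul_legendreQuadratic a hr fun j => u j a, ← integral_sub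
          (integrable_uniformInterval a (by fun_prop) r)
          (integrable_uniformInterval a (by fun_prop) r)]
        simp only [T, sub_mul]
    _ ≤ ∫ t, 2 / 3 * K * r ^ 2 * (t - a) ^ 4 ∂uniformInterval a r :=
        norm_integral_le_of_norm_le (integrable_uniformInterval a (by fun_prop) r) hbound
    _ = 2 * r ^ 4 / 45 * (3 * K * r ^ 2) := by
        rw [integral_const_mul, integral_pow_uniformInterval a hr 4, if_pos ⟨2, rfl⟩]
        push_cast
        ring

end UniformInterval

section UniformBox

variable {ι : Type*} [Fintype ι] (φ : ι → ℝ) {r : ℝ} {p : ι}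

/-- The uniform distribution on the cube of half-width `r` around `φ`, as a product measure. -/
noncomputable abbrev uniformBox (r : ℝ) : Measure (ι → ℝ) :=
  Measure.pi fun i => uniformInterval (φ i) r

theorem cond_volume_Icc_eq_uniformBox (hr : 0 < r) :
    cond volume (Icc (fun i => φ i - r) (fun i => φ i + r)) = uniformBox φ r := by
  rw [← pi_univ_Icc, volume_pi, cond_pi_univ_pi _ (fun _ => measurableSet_Icc)
    (fun i => volume_Icc_sub_add_ne_zero (φ i) hr) fun _ => measure_Icc_lt_top.ne]
  rfl

theorem measurePreserving_eval_uniformBox (hr : 0 < r) (p : ι) :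
    MeasurePreserving (fun y => y p) (uniformBox φ r) (uniformInterval (φ p) r) :=
  have := fun i => isProbabilityMeasure_uniformInterval (φ i) hr
  measurePreserving_eval _ p

theorem memLp_legendreQuadratic_eval (hr : 0 < r) (p : ι) (q : ENNReal) :
    MemLp (fun y => legendreQuadratic (φ p) r (y p)) q (uniformBox φ r) :=
  (memLp_uniformInterval (φ p) (continuous_legendreQuadratic (φ p) r) r q).comp_measurePreserving
    (measurePreserving_eval_uniformBox φ hr p)

theorem integral_legendreQuadratic_eval (hr : 0 < r) (p : ι) :
    ∫ y, legendreQuadratic (φ p) r (y p) ∂uniformBox φ r = 0 := by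
  have hp := measurePreserving_eval_uniformBox φ hr p
  rw [← integral_legendreQuadratic (φ p) hr, ← hp.map_eq,
    integral_map hp.aemeasurable (by fun_prop)]

theorem variance_legendreQuadratic_eval (hr : 0 < r) (p : ι) :
    Var[fun y => legendreQuadratic (φ p) r (y p); uniformBox φ r] = 4 * r ^ 4 / 45 := by
  rw [← variance_legendreQuadratic (φ p) hr]
  exact (measurePreserving_eval_uniformBox φ hr p).variance_fun_comp (by fun_prop)

variable [DecidableEq ι]

theorem abs_covariance_legendreQuadratic_sub_le {g : ℕ → (ι → ℝ) → ℝ} {K : ℝ}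
    (hg : ∀ j < 4, ∀ x t, HasDerivAt (fun s => g j (update x p s)) (g (j + 1) (update x p t)) t)
    (hK : ∀ x, |g 4 x| ≤ K) (hr : 0 < r) (hg₀ : MemLp (g 0) 2 (uniformBox φ r))
    (hg₂ : Integrable (fun y => g 2 (update y p (φ p))) (uniformBox φ r)) :
    |cov[g 0, fun y => legendreQuadratic (φ p) r (y p); uniformBox φ r] -
      2 * r ^ 4 / 45 * ∫ y, g 2 (update y p (φ p)) ∂uniformBox φ r| ≤
        2 * r ^ 4 / 45 * (3 * K * r ^ 2) := by
  have := fun i => isProbabilityMeasure_uniformInterval (φ i) hr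
  have hP := memLp_legendreQuadratic_eval φ hr p 2
  have hint : Integrable (fun y => g 0 y * legendreQuadratic (φ p) r (y p)) (uniformBox φ r) :=
    hg₀.integrable_mul hP
  have hcoord (y : ι → ℝ) : |∫ t, g 0 (update y p t) * legendreQuadratic (φ p) r (update y p t p)
      ∂uniformInterval (φ p) r - 2 * r ^ 4 / 45 * g 2 (update y p (φ p))| ≤
        2 * r ^ 4 / 45 * (3 * K * r ^ 2) := by
    simpa only [update_self] using abs_integral_mul_legendreQuadratic_sub_le (φ p)
      (u := fun j t => g j (update y p t)) (fun j hj => hg j hj y) (fun t => hK _) hr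
  rw [covariance_eq_sub hg₀ hP, integral_legendreQuadratic_eval φ hr p, mul_zero, sub_zero]
  simp only [Pi.mul_apply]
  rw [← integral_integral_update _ p hint, ← integral_const_mul,
    ← integral_sub (integrable_integral_update _ p hint) (hg₂.const_mul _)]
  simpa using! norm_integral_le_of_norm_le_const (μ := uniformBox φ r)
    (f := fun y => ∫ t, g 0 (update y p t) * legendreQuadratic (φ p) r (update y p t p)
      ∂uniformInterval (φ p) r - 2 * r ^ 4 / 45 * g 2 (update y p (φ p))) (.of_forall hcoord)

theorem PartialsBounded.abs_integral_update_self_sub_le {w : ι → ℝ} {C : ℝ} {f : (ι → ℝ) → ℝ}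
    (hf : PartialsBounded w 2 C f) (hr : 0 < r) (p : ι) :
    |∫ y, f (update y p (φ p)) ∂uniformBox φ r - f φ| ≤
      C * (∑ q ∈ Finset.univ.erase p, w q ^ 2) * (r ^ 2 / 3) := by
  have := fun i => isProbabilityMeasure_uniformInterval (φ i) hr
  have h := hf.abs_integral_piecewise_sub_le (fun i => uniformInterval (φ i) r)
    (fun i => memLp_uniformInterval (φ i) continuous_id r 2)
    (fun i => integral_id_uniformInterval (φ i) hr) (Finset.univ.erase p)
  simpa only [Finset.piecewise_erase_univ, variance_id_uniformInterval _ hr, ← Finset.sum_mul,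
    ← mul_assoc] using h

theorem PartialsBounded.exists_le_variance_uniformBox {w : ι → ℝ} {C : ℝ} {f : (ι → ℝ) → ℝ}
    (hf : PartialsBounded w 4 C f) (hr : 0 < r) (p : ι) :
    ∃ d, |d| ≤ C * w p ^ 2 ∧
      |d - iteratedDeriv 2 (fun t => f (update φ p t)) (φ p)| ≤
        C * w p ^ 2 * (∑ q ∈ Finset.univ.erase p, w q ^ 2) * (r ^ 2 / 3) ∧
      r ^ 4 / 45 * (d ^ 2 - 6 * (|d| * (C * w p ^ 4)) * r ^ 2) ≤ Var[f; uniformBox φ r] := by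
  have := fun i => isProbabilityMeasure_uniformInterval (φ i) hr
  obtain ⟨g, rfl, hg, hbound⟩ := hf.exists_iterated_partials p
  have hderiv : iteratedDeriv 2 (fun t => g 0 (update φ p t)) (φ p) = g 2 φ := by
    have := iteratedDeriv_eq_of_hasDerivAt (u := fun j t => g j (update φ p t)) (n := 2)
      fun j hj => hg j (by lia) φ
    simpa using congrFun this (φ p)
  have hg₂ : PartialsBounded w 2 (C * w p ^ 2) (g 2) := hbound 2 (by lia)
  have hg₀ : MemLp (g 0) 2 (uniformBox φ r) := hf.memLp_comp continuous_id 2 _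
  have hcov := abs_covariance_legendreQuadratic_sub_le φ hg (hbound 4 le_rfl).norm_le hr hg₀
    (hg₂.integrable_comp (by fun_prop) _)
  have hvar := mul_sub_le_variance_mul_variance hg₀ (memLp_legendreQuadratic_eval φ hr p 2)
    (by positivity) hcov
  rw [variance_legendreQuadratic_eval φ hr p] at hvar
  refine ⟨∫ y, g 2 (update y p (φ p)) ∂uniformBox φ r, ?_, ?_, ?_⟩
  · simpa using norm_integral_le_of_norm_le_const (μ := uniformBox φ r)
      (.of_forall fun y => hg₂.norm_le (update y p (φ p)))
  · rw [hderiv]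
    exact hg₂.abs_integral_update_self_sub_le φ hr p
  · refine le_of_mul_le_mul_right (hvar.trans_eq' ?_) (by positivity : 0 < 4 * r ^ 4 / 45)
    ring

theorem PartialsBounded.variance_uniformBox_ge {w : ι → ℝ} {C c : ℝ} {f : (ι → ℝ) → ℝ}
    (hf : PartialsBounded w 4 C f) (hr : 0 < r)
    (hc : c = |iteratedDeriv 2 (fun t => f (update φ p t)) (φ p)|)
    (hsmall : 8 / 3 * C * w p ^ 2 * (∑ q ∈ Finset.univ.erase p, w q ^ 2) * r ^ 2 ≤ c) :
    r ^ 4 / 45 * ((c - 8 / 3 * C * w p ^ 2 * (∑ q ∈ Finset.univ.erase p, w q ^ 2) * r ^ 2) ^ 2 -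
      32 / 3 * C ^ 2 * w p ^ 6 * r ^ 2) ≤ Var[f; uniformBox φ r] := by
  obtain ⟨d, hd, hdc, hvar⟩ := hf.exists_le_variance_uniformBox φ hr p
  have hC := hf.nonneg
  set S := ∑ q ∈ Finset.univ.erase p, w q ^ 2
  have hx : 0 ≤ C * w p ^ 2 * S * r ^ 2 := by positivity
  have hcd : c - 8 / 3 * C * w p ^ 2 * S * r ^ 2 ≤ |d| := by
    rw [abs_sub_comm] at hdc
    linarith [abs_sub_abs_le_abs_sub (iteratedDeriv 2 (fun t => f (update φ p t)) (φ p)) d]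
  have hsq : (c - 8 / 3 * C * w p ^ 2 * S * r ^ 2) ^ 2 ≤ d ^ 2 :=
    sq_le_sq.2 ((abs_of_nonneg (sub_nonneg.2 hsmall)).trans_le hcd)
  have hdw : |d| * (C * w p ^ 4) * r ^ 2 ≤ C ^ 2 * w p ^ 6 * r ^ 2 :=
    calc |d| * (C * w p ^ 4) * r ^ 2 ≤ C * w p ^ 2 * (C * w p ^ 4) * r ^ 2 := by gcongr
      _ = C ^ 2 * w p ^ 6 * r ^ 2 := by ring
  have hrem : 0 ≤ C ^ 2 * w p ^ 6 * r ^ 2 := by positivity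
  refine (mul_le_mul_of_nonneg_left ?_ (by positivity)).trans hvar
  linarith

end UniformBox

section Matrix

open scoped Matrix.Norms.L2Operator ComplexOrder

variable {ι : Type*} [Fintype ι] [DecidableEq ι]

theorem norm_trace_vecMulVec_star_mul_le (v : ι → ℂ) (X : Matrix ι ι ℂ) :
    ‖(Matrix.vecMulVec v (star v) * X).trace‖ ≤ (Matrix.vecMulVec v (star v)).trace.re * ‖X‖ := by
  have hinner : X.mulVec v ⬝ᵥ star v =
      inner ℂ (WithLp.toLp 2 v) (Matrix.toEuclideanCLM (𝕜 := ℂ) X (WithLp.toLp 2 v)) := by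
    rw [EuclideanSpace.inner_eq_star_dotProduct]
    rfl
  have hnorm : (v ⬝ᵥ star v).re = ‖WithLp.toLp 2 v‖ ^ 2 := by
    rw [← EuclideanSpace.inner_toLp_toLp, inner_self_eq_norm_sq_to_K]
    norm_cast
  rw [Matrix.trace_mul_comm, Matrix.mul_vecMulVec, Matrix.trace_vecMulVec,
    Matrix.trace_vecMulVec, hinner, hnorm]
  calc ‖inner ℂ (WithLp.toLp 2 v) (Matrix.toEuclideanCLM (𝕜 := ℂ) X (WithLp.toLp 2 v))‖
      ≤ ‖WithLp.toLp 2 v‖ * (‖X‖ * ‖WithLp.toLp 2 v‖) :=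
        (norm_inner_le_norm _ _).trans (by gcongr; exact ContinuousLinearMap.le_opNorm _ _)
    _ = ‖WithLp.toLp 2 v‖ ^ 2 * ‖X‖ := by ring

theorem norm_trace_mul_le_of_posSemidef {ρ : Matrix ι ι ℂ} (hρ : ρ.PosSemidef)
    (X : Matrix ι ι ℂ) : ‖(ρ * X).trace‖ ≤ ρ.trace.re * ‖X‖ := by
  obtain ⟨k, v, rfl⟩ := Matrix.posSemidef_iff_eq_sum_vecMulVec.1 hρ
  rw [Finset.sum_mul, Matrix.trace_sum, Matrix.trace_sum, Complex.re_sum, Finset.sum_mul]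
  exact norm_sum_le_of_le _ fun i _ => norm_trace_vecMulVec_star_mul_le (v i) X

/-- The real-linear functional `X ↦ Re Tr (ρ X)`. -/
noncomputable def reTraceMul (ρ : Matrix ι ι ℂ) : Matrix ι ι ℂ →L[ℝ] ℝ :=
  Complex.reCLM ∘L
    (LinearMap.toContinuousLinearMap (Matrix.traceLinearMap ι ℝ ℂ ∘ₗ LinearMap.mulLeft ℝ ρ))

theorem reTraceMul_apply (ρ X : Matrix ι ι ℂ) : reTraceMul ρ X = (ρ * X).trace.re := rfl

theorem norm_reTraceMul_le {ρ : Matrix ι ι ℂ} (hρ : ρ.PosSemidef) :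
    ‖reTraceMul ρ‖ ≤ ρ.trace.re :=
  ContinuousLinearMap.opNorm_le_bound _ (Complex.nonneg_iff.1 hρ.trace_nonneg).1 fun X =>
    (Complex.abs_re_le_norm _).trans (norm_trace_mul_le_of_posSemidef hρ X)

theorem norm_sub_smul_one_of_isHermitian {H : Matrix ι ι ℂ} (hH : H.IsHermitian) (μ : ℝ) :
    ‖H - (μ : ℂ) • (1 : Matrix ι ι ℂ)‖ = ‖fun i => hH.eigenvalues i - μ‖ := by
  have hdiag : Unitary.conjStarAlgAut ℂ (Matrix ι ι ℂ) hH.eigenvectorUnitary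
      (Matrix.diagonal fun i => ((hH.eigenvalues i - μ : ℝ) : ℂ)) =
      H - (μ : ℂ) • (1 : Matrix ι ι ℂ) := by
    have hsub : (Matrix.diagonal fun i => ((hH.eigenvalues i - μ : ℝ) : ℂ)) =
        Matrix.diagonal (RCLike.ofReal ∘ hH.eigenvalues) - (μ : ℂ) • (1 : Matrix ι ι ℂ) := by
      rw [Matrix.smul_one_eq_diagonal, Matrix.diagonal_sub]
      simp
    rw [hsub, map_sub, ← hH.spectral_theorem, map_smul, map_one]
  rw [← hdiag, Unitary.conjStarAlgAut_apply,
    CStarRing.norm_mul_mem_unitary _ (Unitary.star_mem (SetLike.coe_mem _)),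
    CStarRing.norm_coe_unitary_mul, Matrix.l2_opNorm_diagonal]
  simp only [Pi.norm_def, Complex.nnnorm_real]

end Matrix

namespace QubitOp

open scoped Matrix.Norms.L2Operator

variable {n : ℕ} {H : QubitOp n} (hH : H.IsHermitian)

theorem maxFreq_nonneg : 0 ≤ H.maxFreq hH :=
  sub_nonneg.2 ((ciInf_le (finite_range _).bddBelow (0 : Fin n → Fin 2)).trans
    (le_ciSup (finite_range _).bddAbove _))

theorem maxFreq_le : H.maxFreq hH ≤ 2 * H.opNorm := by
  have habs (i : Fin n → Fin 2) : |hH.eigenvalues i| ≤ H.opNorm := by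
    have hnorm := norm_sub_smul_one_of_isHermitian hH 0
    simp only [Complex.ofReal_zero, zero_smul, sub_zero] at hnorm
    exact (norm_le_pi_norm hH.eigenvalues i).trans_eq hnorm.symm
  have hsup : ⨆ i, hH.eigenvalues i ≤ H.opNorm := ciSup_le fun i => (abs_le.1 (habs i)).2
  have hinf : -H.opNorm ≤ ⨅ i, hH.eigenvalues i := le_ciInf fun i => (abs_le.1 (habs i)).1
  rw [maxFreq]
  linarith

/-- The midpoint of the smallest interval containing the spectrum: subtracting it from `H` leaves
an operator of norm half the maximal frequency. -/
noncomputable def spectralMidpoint (H : QubitOp n) (hH : H.IsHermitian) : ℝ :=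
  ((⨆ i, hH.eigenvalues i) + ⨅ i, hH.eigenvalues i) / 2

theorem norm_sub_spectralMidpoint_le :
    ‖H - (H.spectralMidpoint hH : ℂ) • (1 : QubitOp n)‖ ≤ H.maxFreq hH / 2 := by
  rw [norm_sub_smul_one_of_isHermitian hH,
    pi_norm_le_iff_of_nonneg (div_nonneg (maxFreq_nonneg hH) two_pos.le)]
  intro i
  have hinf := ciInf_le (finite_range hH.eigenvalues).bddBelow i
  have hsup := le_ciSup (finite_range hH.eigenvalues).bddAbove i
  rw [Real.norm_eq_abs, maxFreq, spectralMidpoint, abs_le]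
  constructor <;> linarith

end QubitOp

namespace QuantumLoss

open scoped Matrix.Norms.L2Operator ComplexOrder

variable {n m M : ℕ} (Q : QuantumLoss n m M)

/-- The skew-adjoint operator `-i (H_l - μ)` with `μ` the spectral midpoint of `H_l`. It generates
the same rotations as `H_l` up to a phase and has the least possible norm. -/
noncomputable def centeredGenerator (l : Fin M) : QubitOp n :=
  -Complex.I • (Q.H l - ((Q.H l).spectralMidpoint (Q.H_hermitian l) : ℂ) • (1 : QubitOp n))

theorem norm_centeredGenerator_le (l : Fin M) :
    ‖Q.centeredGenerator l‖ ≤ (Q.H l).maxFreq (Q.H_hermitian l) / 2 := by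
  simpa only [centeredGenerator, norm_smul, norm_neg, Complex.norm_I, one_mul] using
    QubitOp.norm_sub_spectralMidpoint_le (Q.H_hermitian l)

theorem centeredGenerator_mem_skewAdjoint (l : Fin M) :
    Q.centeredGenerator l ∈ skewAdjoint (QubitOp n) := by
  rw [skewAdjoint.mem_iff, centeredGenerator, star_smul, star_sub, star_smul, star_one,
    Matrix.star_eq_conjTranspose, (Q.H_hermitian l).eq]
  simp

theorem norm_exp_smul_centeredGenerator_le_one (l : Fin M) (t : ℝ) :
    ‖NormedSpace.exp (t • Q.centeredGenerator l)‖ ≤ 1 := by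
  let : NormedAlgebra ℚ (QubitOp n) := NormedAlgebra.restrictScalars ℚ ℝ (QubitOp n)
  exact (CStarRing.norm_of_mem_unitary (NormedSpace.exp_mem_unitary_of_mem_skewAdjoint
    (skewAdjoint.smul_mem t (Q.centeredGenerator_mem_skewAdjoint l)))).le

theorem exists_gate_eq_smul_exp (l : Fin M) (t : ℝ) :
    ∃ c : ℂ, ‖c‖ = 1 ∧ Q.gate l t = c • NormedSpace.exp (t • Q.centeredGenerator l) := by
  let : NormedAlgebra ℚ (QubitOp n) := NormedAlgebra.restrictScalars ℚ ℝ (QubitOp n)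
  set μ := (Q.H l).spectralMidpoint (Q.H_hermitian l) with hμ
  refine ⟨Complex.exp (-Complex.I * t * μ), by simp [Complex.norm_exp], ?_⟩
  have hsplit : (-Complex.I * (t : ℂ)) • Q.H l =
      (-Complex.I * t * (μ : ℂ)) • (1 : QubitOp n) + t • Q.centeredGenerator l := by
    rw [centeredGenerator, ← hμ, ← Complex.coe_smul t, smul_smul, smul_sub, smul_smul,
      mul_comm (t : ℂ) (-Complex.I)]
    abel
  rw [gate, hsplit, NormedSpace.exp_add_of_commute ((Commute.one_left _).smul_left _),
    ← Algebra.algebraMap_eq_smul_one, ← NormedSpace.algebraMap_exp_comm,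
    ← Complex.exp_eq_exp_ℂ, Algebra.algebraMap_eq_smul_one, smul_one_mul]

/-- The circuit with every generator replaced by its centered version. -/
noncomputable def centeredCircuit (θ : Fin m → ℝ) : QubitOp n :=
  (List.ofFn fun l : Fin M =>
    Q.V l * NormedSpace.exp (θ (Q.S l) • Q.centeredGenerator l)).prod

theorem exists_circuit_eq_smul_centeredCircuit (θ : Fin m → ℝ) :
    ∃ c : ℂ, ‖c‖ = 1 ∧ Q.circuit θ = c • Q.centeredCircuit θ := by
  rw [circuit, centeredCircuit, List.ofFn_eq_map, List.ofFn_eq_map]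
  induction List.finRange M with
  | nil => exact ⟨1, norm_one, (one_smul _ _).symm⟩
  | cons l L ih =>
    obtain ⟨c, hc, hprod⟩ := ih
    obtain ⟨d, hd, hgate⟩ := Q.exists_gate_eq_smul_exp l (θ (Q.S l))
    refine ⟨d * c, by rw [norm_mul, hd, hc, one_mul], ?_⟩
    rw [List.map_cons, List.prod_cons, hprod, hgate, List.map_cons, List.prod_cons,
      mul_smul_comm, mul_smul_comm, smul_mul_assoc, smul_smul, mul_comm c d]

theorem loss_eq_reTraceMul (θ : Fin m → ℝ) :
    Q.loss θ =
      reTraceMul Q.rho (star (Q.centeredCircuit θ) * Q.O * Q.centeredCircuit θ) := by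
  obtain ⟨c, hc, hcircuit⟩ := Q.exists_circuit_eq_smul_centeredCircuit θ
  have hphase : star c * c = 1 := by
    rw [Complex.star_def, Complex.conj_mul', hc, Complex.ofReal_one, one_pow]
  rw [loss, reTraceMul_apply, hcircuit, Matrix.conjTranspose_smul, ← Matrix.star_eq_conjTranspose]
  simp only [smul_mul_assoc, mul_smul_comm, smul_smul, hphase, one_smul]
  rw [mul_assoc, mul_assoc, Matrix.trace_mul_comm]
  simp only [mul_assoc]

theorem omega_nonneg (q : Fin m) : 0 ≤ Q.omega q :=
  Finset.sum_nonneg fun _ _ => QubitOp.maxFreq_nonneg _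

theorem sum_single_maxFreq_eq_omega :
    ∑ l, (Pi.single (Q.S l) ((Q.H l).maxFreq (Q.H_hermitian l)) : Fin m → ℝ) = Q.omega := by
  ext q
  simp only [omega, Finset.sum_apply, Finset.sum_filter, Pi.single_apply, eq_comm]

theorem partialsBounded_centeredCircuit (k : ℕ) :
    PartialsBounded ((1 / 2 : ℝ) • Q.omega) k 1 Q.centeredCircuit := by
  have hfactor (l : Fin M) : PartialsBounded
      ((1 / 2 : ℝ) • Pi.single (Q.S l) ((Q.H l).maxFreq (Q.H_hermitian l))) k 1
      (fun θ : Fin m → ℝ => Q.V l * NormedSpace.exp (θ (Q.S l) • Q.centeredGenerator l)) := by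
    have hV := PartialsBounded.const (le_refl (0 : Fin m → ℝ)) k
      (CStarRing.norm_of_mem_unitary (Q.V_unitary l)).le
    have hexp := PartialsBounded.exp_smul (i := Q.S l)
      (Q.norm_centeredGenerator_le l) (Q.norm_exp_smul_centeredGenerator_le_one l) k
    rw [← Pi.single_smul', smul_eq_mul, one_div_mul_eq_div]
    have hmul := hV.mul hexp
    rw [zero_add, one_mul] at hmul
    exact hmul
  have hprod := PartialsBounded.list_prod hfactor (List.finRange M)
  rw [← List.ofFn_eq_map, List.sum_ofFn, ← Finset.smul_sum, sum_single_maxFreq_eq_omega] at hprod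
  have hcircuit : Q.centeredCircuit = (List.ofFn fun l (θ : Fin m → ℝ) =>
      Q.V l * NormedSpace.exp (θ (Q.S l) • Q.centeredGenerator l)).prod := by
    ext1 θ
    rw [centeredCircuit, Pi.list_prod_apply, List.map_ofFn, comp_def]
  rw [hcircuit, List.ofFn_eq_map]
  exact hprod

theorem partialsBounded_loss (k : ℕ) : PartialsBounded Q.omega k Q.O.opNorm Q.loss := by
  have hU := Q.partialsBounded_centeredCircuit k
  have hUstar := hU.clm_comp ((starL' ℝ : QubitOp n ≃L[ℝ] QubitOp n) : QubitOp n →L[ℝ] QubitOp n)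
    (c := 1) (ContinuousLinearMap.opNorm_le_bound _ zero_le_one fun A => by simp)
  have hO := PartialsBounded.const (le_refl (0 : Fin m → ℝ)) k (le_refl ‖Q.O‖)
  have htrace : ‖reTraceMul Q.rho‖ ≤ 1 := by
    simpa only [Q.rho_trace, Complex.one_re] using norm_reTraceMul_le Q.rho_posSemidef
  have hloss := ((hUstar.mul hO).mul hU).clm_comp _ htrace
  rw [show (1 / 2 : ℝ) • Q.omega + 0 + (1 / 2 : ℝ) • Q.omega = Q.omega by module,
    one_mul, one_mul, one_mul, mul_one] at hloss
  rw [funext Q.loss_eq_reTraceMul]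
  exact hloss

end QuantumLoss

namespace QuantumLoss

variable {n m M : ℕ} (Q : QuantumLoss n m M)

theorem curvature_nonneg (φ : Fin m → ℝ) (p : Fin m) : 0 ≤ Q.curvature φ p := abs_nonneg _

theorem otherOmegaSq_nonneg (p : Fin m) : 0 ≤ Q.otherOmegaSq p :=
  Finset.sum_nonneg fun _ _ => sq_nonneg _

theorem otherOmegaSq_eq_sum_erase (p : Fin m) :
    Q.otherOmegaSq p = ∑ q ∈ Finset.univ.erase p, Q.omega q ^ 2 := by
  rw [otherOmegaSq, Finset.filter_ne']

theorem lossVariance_eq_variance_uniformBox (φ : Fin m → ℝ) {r : ℝ} (hr : 0 < r) :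
    Q.lossVariance φ r = Var[Q.loss; uniformBox φ r] := by
  rw [lossVariance, hypercube, cond_volume_Icc_eq_uniformBox φ hr]

/-- The denominator `D` of the squared patch radius `9 c ^ 2 / (8 D)`. The condition
`8 D r ^ 2 ≤ 9 c ^ 2` on a radius also makes sense for `D = 0`, where `patchRadiusSq` is zero. -/
noncomputable def patchDenominator (φ : Fin m → ℝ) (p : Fin m) : ℝ :=
  16 * Q.curvature φ p * Q.O.opNorm * Q.omega p ^ 2 * Q.otherOmegaSq p
    + 32 * Q.O.opNorm ^ 2 * Q.omega p ^ 6

theorem patchDenominator_nonneg (φ : Fin m → ℝ) (p : Fin m) : 0 ≤ Q.patchDenominator φ p := by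
  have hO : 0 ≤ Q.O.opNorm := norm_nonneg _
  have hc := Q.curvature_nonneg φ p
  have hS := Q.otherOmegaSq_nonneg p
  unfold patchDenominator
  positivity

variable {Q} {φ : Fin m → ℝ} {p : Fin m} {r : ℝ}

theorem cross_term_le_curvature (hc : 0 < Q.curvature φ p)
    (h : 8 * Q.patchDenominator φ p * r ^ 2 ≤ 9 * Q.curvature φ p ^ 2) :
    8 / 3 * Q.O.opNorm * Q.omega p ^ 2 * Q.otherOmegaSq p * r ^ 2 ≤ Q.curvature φ p := by
  have hω := Q.omega_nonneg p
  have hnonneg : 0 ≤ Q.O.opNorm ^ 2 * Q.omega p ^ 6 * r ^ 2 := by positivity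
  refine le_of_mul_le_mul_left ?_ hc
  rw [patchDenominator] at h
  linarith [sq_nonneg (Q.curvature φ p)]

theorem varianceBound_le_lossVariance (hr : 0 < r) (hc : 0 < Q.curvature φ p)
    (h : 8 * Q.patchDenominator φ p * r ^ 2 ≤ 9 * Q.curvature φ p ^ 2) :
    Q.varianceBound φ p r ≤ Q.lossVariance φ r := by
  have hcross := cross_term_le_curvature hc h
  rw [varianceBound, Q.lossVariance_eq_variance_uniformBox φ hr]
  rw [otherOmegaSq_eq_sum_erase] at hcross ⊢
  exact (Q.partialsBounded_loss 4).variance_uniformBox_ge φ hr rfl hcross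

theorem curvature_sq_mul_le_varianceBound
    (h : 8 * Q.patchDenominator φ p * r ^ 2 ≤ 9 * Q.curvature φ p ^ 2) :
    1 / 72 * Q.curvature φ p ^ 2 * r ^ 4 ≤ Q.varianceBound φ p r := by
  have hbracket : 5 / 8 * Q.curvature φ p ^ 2 ≤
      (Q.curvature φ p - 8 / 3 * Q.O.opNorm * Q.omega p ^ 2 * Q.otherOmegaSq p * r ^ 2) ^ 2
        - 32 / 3 * Q.O.opNorm ^ 2 * Q.omega p ^ 6 * r ^ 2 := by
    rw [patchDenominator] at h
    linarith [sq_nonneg (8 / 3 * Q.O.opNorm * Q.omega p ^ 2 * Q.otherOmegaSq p * r ^ 2)]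
  calc 1 / 72 * Q.curvature φ p ^ 2 * r ^ 4 = r ^ 4 / 45 * (5 / 8 * Q.curvature φ p ^ 2) := by ring
    _ ≤ Q.varianceBound φ p r := mul_le_mul_of_nonneg_left hbracket (by positivity)

theorem patchDenominator_mul_sq_le_of_le_patchRadiusSq (hr : 0 < r)
    (h : r ^ 2 ≤ Q.patchRadiusSq φ p) :
    0 < Q.curvature φ p ∧ 8 * Q.patchDenominator φ p * r ^ 2 ≤ 9 * Q.curvature φ p ^ 2 := by
  change r ^ 2 ≤ 9 * Q.curvature φ p ^ 2 / (8 * Q.patchDenominator φ p) at h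
  have hpos := (pow_pos hr 2).trans_le h
  have hc : Q.curvature φ p ≠ 0 := by
    rintro hc
    simp [hc] at hpos
  have hD : Q.patchDenominator φ p ≠ 0 := by
    rintro hD
    simp [hD] at hpos
  have hD_pos := (Q.patchDenominator_nonneg φ p).lt_of_ne' hD
  rw [le_div_iff₀' (by positivity)] at h
  exact ⟨(Q.curvature_nonneg φ p).lt_of_ne' hc, h⟩

end QuantumLoss

section Asymptotics

open Filter Asymptotics

theorem isLittleO_natCast_pow_div_pow {i j l : ℕ} (h : i + l < j) :
    (fun n : ℕ => (n : ℝ) ^ i / (n : ℝ) ^ j) =o[atTop] fun n : ℕ => 1 / (n : ℝ) ^ l := by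
  have hpow : (fun n : ℕ => (n : ℝ) ^ (i + l)) =o[atTop] fun n : ℕ => (n : ℝ) ^ j :=
    (isLittleO_pow_pow_atTop_of_lt h).comp_tendsto tendsto_natCast_atTop_atTop
  refine (hpow.mul_isBigO (isBigO_refl (fun n : ℕ => 1 / ((n : ℝ) ^ j * (n : ℝ) ^ l)) _)).congr'
    ?_ ?_
  · filter_upwards [eventually_ne_atTop 0] with n hn
    field_simp
    ring
  · filter_upwards [eventually_ne_atTop 0] with n hn
    field_simp

end Asymptotics

namespace QuantumLoss

open Filter Asymptotics

theorem omega_le {n m M : ℕ} (Q : QuantumLoss n m M) {N h : ℝ} {q : Fin m} (h0 : 0 ≤ h)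
    (hcard : ((Finset.univ.filter fun l => Q.S l = q).card : ℝ) ≤ N)
    (hH : ∀ l, (Q.H l).opNorm ≤ h) : Q.omega q ≤ N * (2 * h) := by
  have hsum := Finset.sum_le_card_nsmul (Finset.univ.filter fun l => Q.S l = q)
    (fun l => (Q.H l).maxFreq (Q.H_hermitian l)) (2 * h) fun l _ =>
      (QubitOp.maxFreq_le (Q.H_hermitian l)).trans (mul_le_mul_of_nonneg_left (hH l) two_pos.le)
  rw [nsmul_eq_mul] at hsum
  exact hsum.trans (mul_le_mul_of_nonneg_right hcard (by positivity))

theorem otherOmegaSq_le {n m M : ℕ} (Q : QuantumLoss n m M) (p : Fin m) {b : ℝ}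
    (hb : ∀ q, Q.omega q ≤ b) : Q.otherOmegaSq p ≤ m * b ^ 2 := by
  calc Q.otherOmegaSq p ≤ ∑ q, Q.omega q ^ 2 :=
        Finset.sum_le_sum_of_subset_of_nonneg (Finset.filter_subset _ _)
          fun _ _ _ => sq_nonneg _
    _ ≤ ∑ _q : Fin m, b ^ 2 :=
        Finset.sum_le_sum fun q _ => pow_le_pow_left₀ (Q.omega_nonneg q) (hb q) 2
    _ = m * b ^ 2 := by simp

variable {a k : ℕ} {m M : ℕ → ℕ} {Q : ∀ n : ℕ, QuantumLoss n (m n) (M n)}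
  {φ : ∀ n : ℕ, Fin (m n) → ℝ} {p : ∀ n : ℕ, Fin (m n)} {r : ℕ → ℝ}

theorem exists_eventually_omega_le
    (hH : ∃ C : ℝ, ∀ᶠ n : ℕ in atTop, ∀ l, ((Q n).H l).opNorm ≤ C * (n : ℝ) ^ a)
    (hcard : ∃ C : ℝ, ∀ᶠ n : ℕ in atTop, ∀ q : Fin (m n),
      ((Finset.univ.filter fun l => (Q n).S l = q).card : ℝ) ≤ C * (n : ℝ) ^ a) :
    ∃ C : ℝ, ∀ᶠ n : ℕ in atTop, ∀ q, (Q n).omega q ≤ C * (n : ℝ) ^ (2 * a) := by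
  obtain ⟨B, hB⟩ := hH
  obtain ⟨N, hN⟩ := hcard
  refine ⟨2 * N * |B|, ?_⟩
  filter_upwards [hB, hN] with n hB hN q
  have hB' : ∀ l, ((Q n).H l).opNorm ≤ |B| * (n : ℝ) ^ a := fun l =>
    (hB l).trans (mul_le_mul_of_nonneg_right (le_abs_self B) (by positivity))
  exact ((Q n).omega_le (by positivity) (hN q) hB').trans_eq (by ring)

theorem isBigO_omega
    (hω : ∃ C : ℝ, ∀ᶠ n : ℕ in atTop, ∀ q, (Q n).omega q ≤ C * (n : ℝ) ^ (2 * a)) :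
    (fun n => (Q n).omega (p n)) =O[atTop] fun n : ℕ => (n : ℝ) ^ (2 * a) := by
  obtain ⟨C, hC⟩ := hω
  refine IsBigO.of_bound C (hC.mono fun n hn => ?_)
  rw [Real.norm_of_nonneg ((Q n).omega_nonneg _), Real.norm_of_nonneg (by positivity)]
  exact hn (p n)

theorem isBigO_otherOmegaSq
    (hω : ∃ C : ℝ, ∀ᶠ n : ℕ in atTop, ∀ q, (Q n).omega q ≤ C * (n : ℝ) ^ (2 * a)) :
    (fun n => (Q n).otherOmegaSq (p n)) =O[atTop] fun n : ℕ => (m n : ℝ) * (n : ℝ) ^ (4 * a) := by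
  obtain ⟨C, hC⟩ := hω
  refine IsBigO.of_bound (C ^ 2) (hC.mono fun n hn => ?_)
  rw [Real.norm_of_nonneg ((Q n).otherOmegaSq_nonneg _), Real.norm_of_nonneg (by positivity)]
  exact ((Q n).otherOmegaSq_le (p n) hn).trans_eq (by ring)

theorem isLittleO_patchDenominator_mul_sq (hk : 8 * a < k)
    (hO : (fun n => (Q n).O.opNorm) =O[atTop] fun n : ℕ => (n : ℝ) ^ a)
    (hω : ∃ C : ℝ, ∀ᶠ n : ℕ in atTop, ∀ q, (Q n).omega q ≤ C * (n : ℝ) ^ (2 * a))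
    (hc : (fun n : ℕ => 1 / (n : ℝ) ^ a) =O[atTop] fun n => (Q n).curvature (φ n) (p n))
    (hr : r =O[atTop] fun n : ℕ => 1 / ((n : ℝ) ^ k * √(m n : ℝ))) :
    (fun n => (Q n).patchDenominator (φ n) (p n) * r n ^ 2) =o[atTop]
      fun n => (Q n).curvature (φ n) (p n) ^ 2 := by
  have hm (n : ℕ) : (m n : ℝ) ≠ 0 := Nat.cast_ne_zero.2 (p n).pos.ne'
  have hωp := isBigO_omega (p := p) hω
  have hr_sq : (fun n => r n ^ 2) =O[atTop] fun n : ℕ => 1 / (m n * (n : ℝ) ^ (2 * k)) :=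
    (hr.pow 2).congr_right fun n => by
      rw [div_pow, one_pow, mul_pow, Real.sq_sqrt (Nat.cast_nonneg _), ← pow_mul, mul_comm,
        mul_comm k]
  have hcross : (fun n => (Q n).O.opNorm * (Q n).omega (p n) ^ 2 * (Q n).otherOmegaSq (p n)
      * r n ^ 2) =o[atTop] fun n => (Q n).curvature (φ n) (p n) := by
    refine IsBigO.trans_isLittleO ?_ ((isLittleO_natCast_pow_div_pow
      (i := 9 * a) (j := 2 * k) (by lia)).trans_isBigO hc)
    refine (((hO.mul (hωp.pow 2)).mul (isBigO_otherOmegaSq hω)).mul hr_sq).congr_right fun n => ?_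
    rw [← mul_div_mul_left ((n : ℝ) ^ (9 * a)) _ (hm n)]
    ring
  have htail : (fun n => (Q n).O.opNorm ^ 2 * (Q n).omega (p n) ^ 6 * r n ^ 2) =o[atTop]
      fun n => (Q n).curvature (φ n) (p n) ^ 2 := by
    have hr_sq' : (fun n => r n ^ 2) =O[atTop] fun n : ℕ => 1 / (n : ℝ) ^ (2 * k) := by
      refine hr_sq.trans (IsBigO.of_norm_le fun n => ?_)
      rw [Real.norm_of_nonneg (by positivity), one_div, mul_inv, one_div]
      exact mul_le_of_le_one_left (by positivity) (Nat.cast_inv_le_one _)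
    refine IsBigO.trans_isLittleO ?_ ((isLittleO_natCast_pow_div_pow
      (i := 14 * a) (j := 2 * k) (l := a * 2) (by lia)).trans_isBigO
        ((hc.pow 2).congr_left fun n => by rw [div_pow, one_pow, pow_mul]))
    exact (((hO.pow 2).mul (hωp.pow 6)).mul hr_sq').congr_right fun n => by ring
  refine ((((isBigO_refl _ _).mul_isLittleO hcross).const_mul_left 16).congr_right
    fun n => (sq _).symm).add (htail.const_mul_left 32) |>.congr_left fun n => ?_
  rw [patchDenominator]
  ring

theorem isBigO_lossVariance (hk : 8 * a < k)
    (hO : (fun n => (Q n).O.opNorm) =O[atTop] fun n : ℕ => (n : ℝ) ^ a)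
    (hω : ∃ C : ℝ, ∀ᶠ n : ℕ in atTop, ∀ q, (Q n).omega q ≤ C * (n : ℝ) ^ (2 * a))
    (hc : (fun n : ℕ => 1 / (n : ℝ) ^ a) =O[atTop] fun n => (Q n).curvature (φ n) (p n))
    (hr_pos : ∀ n, 0 < r n)
    (hr : r =Θ[atTop] fun n : ℕ => 1 / ((n : ℝ) ^ k * √(m n : ℝ))) :
    (fun n : ℕ => 1 / ((n : ℝ) ^ (2 * a + 4 * k) * (m n : ℝ) ^ 2)) =O[atTop]
      fun n => (Q n).lossVariance (φ n) (r n) := by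
  have hsmall := (isLittleO_patchDenominator_mul_sq hk hO hω hc hr.1).def
    (by norm_num : (0 : ℝ) < 9 / 8)
  have hvariance : (fun n => (Q n).curvature (φ n) (p n) ^ 2 * r n ^ 4) =O[atTop]
      fun n => (Q n).lossVariance (φ n) (r n) := by
    refine IsBigO.of_bound 72 ?_
    filter_upwards [hsmall, hc.eq_zero_imp, eventually_ne_atTop 0] with n hsmall hc0 hn
    have hcurv : 0 < (Q n).curvature (φ n) (p n) :=
      ((Q n).curvature_nonneg _ _).lt_of_ne' fun h => by simpa [hn] using hc0 h
    have hradius : 8 * (Q n).patchDenominator (φ n) (p n) * r n ^ 2 ≤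
        9 * (Q n).curvature (φ n) (p n) ^ 2 := by
      have := (Real.le_norm_self _).trans hsmall
      rw [Real.norm_of_nonneg (sq_nonneg _)] at this
      linarith
    have hlower := (curvature_sq_mul_le_varianceBound hradius).trans
      (varianceBound_le_lossVariance (hr_pos n) hcurv hradius)
    rw [Real.norm_of_nonneg (by positivity)]
    linarith [Real.le_norm_self ((Q n).lossVariance (φ n) (r n))]
  refine IsBigO.trans (((hc.pow 2).mul (hr.2.pow 4)).congr_left fun n => ?_) hvariance
  rw [div_pow, div_pow, mul_pow, show √(m n : ℝ) ^ 4 = (√(m n : ℝ) ^ 2) ^ 2 by ring,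
    Real.sq_sqrt (Nat.cast_nonneg _)]
  ring

end QuantumLoss

theorem mainTheorem2 :
    (∀ (n m M : ℕ) (Q : QuantumLoss n m M) (φ : Fin m → ℝ) (p : Fin m) (r : ℝ),
      0 < r → r ^ 2 ≤ Q.patchRadiusSq φ p →
        Q.varianceBound φ p r ≤ Q.lossVariance φ r ∧
        1 / 72 * Q.curvature φ p ^ 2 * r ^ 4 ≤ Q.varianceBound φ p r) ∧
    (∀ a : ℕ, ∃ k₀ : ℕ, ∀ k : ℕ, k₀ ≤ k → ∃ j : ℕ,
      ∀ (m M : ℕ → ℕ) (Q : ∀ n : ℕ, QuantumLoss n (m n) (M n))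
        (φ : ∀ n : ℕ, Fin (m n) → ℝ) (p : ∀ n : ℕ, Fin (m n)) (r : ℕ → ℝ),
        (fun n : ℕ => (Q n).O.opNorm) =O[Filter.atTop] (fun n : ℕ => (n : ℝ) ^ a) →
        (∃ C : ℝ, ∀ᶠ n : ℕ in Filter.atTop, ∀ l : Fin (M n),
          ((Q n).H l).opNorm ≤ C * (n : ℝ) ^ a) →
        (∃ C : ℝ, ∀ᶠ n : ℕ in Filter.atTop, ∀ q : Fin (m n),
          ((Finset.univ.filter (fun l => (Q n).S l = q)).card : ℝ) ≤ C * (n : ℝ) ^ a) →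
        (fun n : ℕ => 1 / (n : ℝ) ^ a) =O[Filter.atTop]
          (fun n : ℕ => (Q n).curvature (φ n) (p n)) →
        (∀ n : ℕ, 0 < r n) →
        r =Θ[Filter.atTop] (fun n : ℕ => 1 / ((n : ℝ) ^ k * √(m n : ℝ))) →
        (fun n : ℕ => 1 / ((n : ℝ) ^ j * (m n : ℝ) ^ 2)) =O[Filter.atTop]
          (fun n : ℕ => (Q n).lossVariance (φ n) (r n))) := by
  refine ⟨fun n m M Q φ p r hr h => ?_, fun a => ⟨8 * a + 1, fun k hk => ⟨2 * a + 4 * k, ?_⟩⟩⟩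
  · obtain ⟨hc, hradius⟩ := QuantumLoss.patchDenominator_mul_sq_le_of_le_patchRadiusSq hr h
    exact ⟨QuantumLoss.varianceBound_le_lossVariance hr hc hradius,
      QuantumLoss.curvature_sq_mul_le_varianceBound hradius⟩
  · intro m M Q φ p r hO hH hcard hc hr_pos hr
    exact QuantumLoss.isBigO_lossVariance hk hO (QuantumLoss.exists_eventually_omega_le hH hcard)
      hc hr_pos hr
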